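/- There is a universal constant $C>0$ with the following property. Let $(\sigma_n)_{n\ge1}$ and $(B_n)_{n\ge1}$ be sequences of positive real numbers with $B_n = o\big(\sigma_n\sqrt{n/\log^3 n}\big)$ as $n\to\infty$. Then there is an $N$, depending only on these two sequences, such that for every $n\ge N$ the following holds, with $\sigma=\sigma_n$ and $B=B_n$. Let $\boldsymbol H=(H_{ij})\in\mathbb R^{n\times n}$ be a random matrix with mutually independent entries such that, for all $1\le i,j\le n$, $\mathbb E H_{ij}=0$, $\operatorname{Var}(H_{ij})=\mathbb E H_{ij}^2\le\sigma^2$, $|H_{ij}|\le B$ almost surely, and $H_{ij}$ has a distribution symmetric about $0$. Let $\boldsymbol x,\boldsymbol y\in\mathbb R^n$ be fixed (deterministic) vectors, let $k\ge2$ be an integer and let $p\ge2$ be an even integer with $kp\le\log^3 n=(\log n)^3$. Then $\boldsymbol x^\top \boldsymbol H^k\boldsymbol y$ has a finite $p$-th moment and $$\mathbb E\big(\boldsymbol x^\top \boldsymbol H^k\boldsymbol y-\mathbb E\,\boldsymbol x^\top \boldsymbol H^k\boldsymbol y\big)^p\le C\,2^{(k+1)p}(kp)^{kp}\,p\,\big(\|\boldsymbol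 x\|_\infty\|\boldsymbol y\|_\infty\big)^p\max\left\{\frac{\sigma^{kp}\,n^{kp/2}\,(\|\boldsymbol x\|_0\|\boldsymbol y\|_0)^{p/2}}{n^{p/2}\,(kp)^{kp/2}},\ \frac{B^{pk}\,\sigma^{2k}\,n^{k}\,\|\boldsymbol x\|_0\|\boldsymbol y\|_0}{B^{2k}\,n\,(kp)^k}\right\},$$ where $\|\boldsymbol v\|_\infty=\max_i|v_i|$ and $\|\boldsymbol v\|_0$ is the number of non-zero entries of $\boldsymbol v$. -/

import Mathlib

open MeasureTheory ProbabilityTheory Filter Asymptotics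

/-- The noise model: `H` is a random real `n × n` matrix (in general not symmetric) on the probability
space `(Ω, P)`, with mutually independent entries that have mean zero, variance at most `σ ^ 2`,
absolute value at most `B` almost surely, and a distribution that is symmetric about `0`. -/
structure IsBoundedSymmetricNoise {Ω : Type*} [MeasurableSpace Ω] (P : Measure Ω) {n : ℕ}
    (H : Ω → Matrix (Fin n) (Fin n) ℝ) (σ B : ℝ) : Prop where
  measurable_entry : ∀ i j, Measurable (fun ω => H ω i j)
  indep : iIndepFun (fun (ij : Fin n × Fin n) (ω : Ω) => H ω ij.1 ij.2) P
  mean_zero : ∀ i j, ∫ ω, H ω i j ∂P = 0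
  variance_le : ∀ i j, variance (fun ω => H ω i j) P ≤ σ ^ 2
  abs_le : ∀ i j, ∀ᵐ ω ∂P, |H ω i j| ≤ B
  symmetric : ∀ i j, P.map (fun ω => H ω i j) = P.map (fun ω => -H ω i j)

/-- The random variable `xᵀ Hᵏ y`. -/
def powerForm {Ω : Type*} {n : ℕ} (H : Ω → Matrix (Fin n) (Fin n) ℝ) (k : ℕ)
    (x y : Fin n → ℝ) : Ω → ℝ :=
  fun ω => x ⬝ᵥ ((H ω ^ k).mulVec y)

/-- The bound on the `p`-th central moment. On `Fin n → ℝ` the norm `‖x‖` is the maximum norm, and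
`hammingNorm x` is the number of non-zero entries of `x`. The exponents `k * p / 2` and `p / 2` are
exact whenever `p` is even. -/
noncomputable def momentBound {n : ℕ} (σ B : ℝ) (k p : ℕ) (x y : Fin n → ℝ) : ℝ :=
  2 ^ ((k + 1) * p) * ((k * p : ℕ) : ℝ) ^ (k * p) * p * (‖x‖ * ‖y‖) ^ p *
    max
      (σ ^ (k * p) * (n : ℝ) ^ (k * p / 2) * ((hammingNorm x : ℝ) * hammingNorm y) ^ (p / 2) /
        ((n : ℝ) ^ (p / 2) * ((k * p : ℕ) : ℝ) ^ (k * p / 2)))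
      (B ^ (p * k) * σ ^ (2 * k) * (n : ℝ) ^ k * hammingNorm x * hammingNorm y /
        (B ^ (2 * k) * n * ((k * p : ℕ) : ℝ) ^ k))

/-! Expand the `p`-th power of `xᵀ Hᵏ y` over families of `p` walks of length `k` from the support
of `x` to that of `y`. By independence and zero means, only families that traverse each of their
directed edges at least twice survive. With `m` distinct edges, such a family contributes at most `B
^ (k * p - 2 * m) * σ ^ (2 * m)`, up to the factor `(‖x‖ * ‖y‖) ^ p`.

Put `L = k * p`, `ρ = σ² n / (B² L)` and `q = ‖x‖₀ ‖y‖₀ / n`. Families are sorted by pattern: an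
idempotent map on the `L` steps that picks one representative step per edge, so that `m` is the size
of its image. Weighted by `L ^ m`, the patterns sum to at most `2 ^ L * L ^ L`
(`sum_idempotent_pow_card_image_le`). It remains to show that the number `y` of families with a
given pattern satisfies `y * ρ ^ m ≤ n ^ m * max ((ρ ^ k * q) ^ (p / 2)) (ρ ^ k * q)`
(`card_walks_mul_pow_le`).

A pattern glues the walks into a graph, and `y` is at most the product over its vertices of the
available labels. Each vertex's count is split into factors charged to an edge leaving it and an
edge entering it; `prod_le_prod_of_fiber` does this bookkeeping, uncharged edges costing nothing
because their factors are at least one. Three such splittings, for `q ≤ 1`, for `q ≥ 1` and an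
interpolating one, are merged in `pow_mul_le_max`. The growth condition on `B` enters only through
`ρ ≥ 1`, and centering costs `2 ^ p`. -/

theorem prod_le_prod_of_fiber {Q E : Type*} [Fintype Q] [Fintype E] (t : E → Q)
    (u : Q → ℝ) (F : E → ℝ) (hF : ∀ e, 1 ≤ F e) (hu : ∀ z, 0 ≤ u z)
    (h : ∀ z, u z ≤ 1 ∨ ∃ e, t e = z ∧ u z ≤ F e) : ∏ z, u z ≤ ∏ e, F e := by
  classical
  rw [← Finset.prod_fiberwise (s := Finset.univ) (g := t) (f := F)]
  refine Finset.prod_le_prod (fun z _ => hu z) fun z _ => ?_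
  have key : ∀ s : Finset E, 1 ≤ ∏ e ∈ s, F e := fun s => by
    simpa using Finset.prod_le_prod (s := s) (f := fun _ => (1 : ℝ)) (g := F)
      (fun _ _ => zero_le_one) fun e _ => hF e
  rcases h z with h1 | ⟨e, he, hle⟩
  · exact h1.trans (key _)
  · rw [← Finset.mul_prod_erase _ _ (by simpa using he : e ∈ Finset.univ.filter fun e => t e = z)]
    nlinarith [key ((Finset.univ.filter fun e => t e = z).erase e), hF e]

open Classical in
/-- The number of labels available to a vertex `z` of a union of walks `v`: `X` if some walk starts
at `z`, otherwise `Y` if some walk ends at `z`, otherwise `n`. -/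
noncomputable def labelCount {Q : Type*} {p k : ℕ} (v : Fin p → Fin (k + 1) → Q) (X Y n : ℝ)
    (z : Q) : ℝ :=
  if ∃ w, v w 0 = z then X else if ∃ w, v w (Fin.last k) = z then Y else n

/-! ### Labelings of a glued union of walks: three charging arguments. -/

section Walks

variable {Q E : Type*} {p k : ℕ} {v : Fin p → Fin (k + 1) → Q}
  {t h : E → Q} {ε : Fin p × Fin k → E} {X Y n : ℝ}

theorem exists_tail_eq (ht : ∀ w j, t (ε (w, j)) = v w j.castSucc) {w : Fin p} {j : Fin (k + 1)}
    (hj : j ≠ Fin.last k) : ∃ j' : Fin k, (j' : ℕ) = j ∧ t (ε (w, j')) = v w j := by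
  obtain ⟨j', rfl⟩ := Fin.exists_castSucc_eq.2 hj
  exact ⟨j', rfl, ht w j'⟩

theorem exists_head_eq (hh : ∀ w j, h (ε (w, j)) = v w j.succ) {w : Fin p} {j : Fin (k + 1)}
    (hj : j ≠ 0) : ∃ e, h e = v w j := by
  obtain ⟨j', rfl⟩ := Fin.exists_succ_eq.2 hj
  exact ⟨_, hh w j'⟩

theorem labelCount_nonneg (hX : 0 ≤ X) (hY : 0 ≤ Y) (hn : 0 ≤ n) (z : Q) :
    0 ≤ labelCount v X Y n z := by
  unfold labelCount; split_ifs <;> assumption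

variable [Fintype Q] [Fintype E]

/-- An interior count `n` splits as `n / Y` for a leaving edge times `Y` for an entering edge, so an
edge collects at most `n`. The first edge of a walk leaves a starting vertex and collects only `X *
Y`, which saves the factor `X * Y / n`. -/
theorem mul_prod_labelCount_le (hv : ∀ z, ∃ w j, v w j = z)
    (ht : ∀ w j, t (ε (w, j)) = v w j.castSucc) (hh : ∀ w j, h (ε (w, j)) = v w j.succ)
    (hp : 0 < p) (hk : 0 < k) (hX : 1 ≤ X) (hY : 1 ≤ Y) (hXY : X * Y ≤ n) :
    n * ∏ z, labelCount v X Y n z ≤ n ^ Fintype.card E * (X * Y) := by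
  classical
  have hn : 1 ≤ n := by nlinarith
  have hYn : X ≤ n / Y := by rw [le_div_iff₀ (by linarith)]; exact hXY
  let u : Q → ℝ := fun z => if ∃ w, v w 0 = z then X else
    if ∃ w, v w (Fin.last k) = z then 1 else n / Y
  let g : Q → ℝ := fun z => if ∃ w, v w 0 = z then 1 else Y
  have hu1 : ∀ z, 1 ≤ u z := fun z => by simp only [u]; split_ifs <;> linarith
  have hun : ∀ z, u z ≤ n / Y := fun z => by simp only [u]; split_ifs <;> linarith
  have hdug : ∀ z, labelCount v X Y n z = u z * g z := fun z => by
    simp only [labelCount, u, g]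
    split_ifs
    · ring
    · ring
    · have : Y ≠ 0 := by linarith
      field_simp
  have h1 : ∏ z, u z ≤ ∏ e, u (t e) := by
    refine prod_le_prod_of_fiber t u _ (fun e => hu1 _) (fun z => by linarith [hu1 z]) fun z => ?_
    obtain ⟨w, j, rfl⟩ := hv z
    by_cases hj : j = Fin.last k
    · by_cases hA : ∃ w', v w' 0 = v w j
      · obtain ⟨w', hw'⟩ := hA
        obtain ⟨j', -, hj'⟩ := exists_tail_eq ht (w := w') (j := 0)
          (by simpa [Fin.ext_iff] using hk.ne)
        exact Or.inr ⟨_, hj'.trans hw', by rw [hj', hw']⟩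
      · left
        simp only [u]
        rw [if_neg hA, if_pos ⟨w, by rw [hj]⟩]
    · obtain ⟨j', -, hj'⟩ := exists_tail_eq ht (w := w) hj
      exact Or.inr ⟨_, hj', by rw [hj']⟩
  have h2 : ∏ z, g z ≤ ∏ _e : E, Y := by
    refine prod_le_prod_of_fiber h g _ (fun e => hY)
      (fun z => by simp only [g]; split_ifs <;> linarith) fun z => ?_
    obtain ⟨w, j, rfl⟩ := hv z
    by_cases hA : ∃ w', v w' 0 = v w j
    · left; simp only [g]; rw [if_pos hA]
    · have hj : j ≠ 0 := by rintro rfl; exact hA ⟨w, rfl⟩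
      obtain ⟨e, he⟩ := exists_head_eq hh (w := w) hj
      exact Or.inr ⟨e, he, by simp only [g]; rw [if_neg hA]⟩
  have h3 : ∏ e, u (t e) ≤ X * (n / Y) ^ (Fintype.card E - 1) := by
    let e₀ := ε (⟨0, hp⟩, ⟨0, hk⟩)
    rw [← Finset.mul_prod_erase _ _ (Finset.mem_univ e₀)]
    have : u (t e₀) = X := if_pos ⟨⟨0, hp⟩, (ht ⟨0, hp⟩ ⟨0, hk⟩).symm⟩
    rw [this]
    refine mul_le_mul_of_nonneg_left ?_ (by linarith)
    refine (Finset.prod_le_prod (fun e _ => by linarith [hu1 (t e)]) fun e _ => hun (t e)).trans ?_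
    rw [Finset.prod_const, Finset.card_erase_of_mem (Finset.mem_univ _), Finset.card_univ]
  have hE : 0 < Fintype.card E := Fintype.card_pos_iff.2 ⟨ε (⟨0, hp⟩, ⟨0, hk⟩)⟩
  obtain ⟨m, hm⟩ : ∃ m, Fintype.card E = m + 1 := ⟨_, (Nat.succ_pred_eq_of_pos hE).symm⟩
  simp_rw [hdug]
  rw [Finset.prod_mul_distrib]
  have h4 : (∏ z, u z) * ∏ z, g z ≤ (X * (n / Y) ^ m) * Y ^ (m + 1) := by
    refine mul_le_mul (h1.trans (by simpa [hm] using h3)) (by simpa [hm] using h2)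
      (Finset.prod_nonneg fun z _ => by simp only [g]; split_ifs <;> linarith)
      (by positivity)
  calc n * ((∏ z, u z) * ∏ z, g z) ≤ n * ((X * (n / Y) ^ m) * Y ^ (m + 1)) :=
        mul_le_mul_of_nonneg_left h4 (by linarith)
    _ = n ^ Fintype.card E * (X * Y) := by
        have : Y ≠ 0 := by linarith
        rw [hm, div_pow]; field_simp; ring

/-- Interior vertices split `n` as `X * τ ^ ℓ` times `Y * τ ^ (k - ℓ)`, where `ℓ` is the latest
position of the vertex in any walk. The first factor is charged to an edge taken at that latest
visit. Such an edge raises `ℓ` by at least one, so a spare `τ` remains on every edge. -/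
theorem prod_labelCount_mul_pow_le (hv : ∀ z, ∃ w j, v w j = z)
    (ht : ∀ w j, t (ε (w, j)) = v w j.castSucc) (hh : ∀ w j, h (ε (w, j)) = v w j.succ)
    (hk : 0 < k) (hX : 1 ≤ X) (hY : 1 ≤ Y) {τ : ℝ} (hτ : 1 ≤ τ)
    (hn : X * Y * τ ^ k = n) :
    (∏ z, labelCount v X Y n z) * τ ^ Fintype.card E ≤ n ^ Fintype.card E := by
  classical
  -- The largest position at which any walk visits `z`.
  let ℓ : Q → ℕ := fun z => (Finset.univ.filter fun wj : Fin p × Fin (k + 1) => v wj.1 wj.2 = z).sup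
    fun wj => (wj.2 : ℕ)
  have hle : ∀ (w : Fin p) (j : Fin (k + 1)), (j : ℕ) ≤ ℓ (v w j) := fun w j =>
    Finset.le_sup (f := fun wj : Fin p × Fin (k + 1) => (wj.2 : ℕ)) (b := (w, j)) (by simp)
  have hex : ∀ z, ∃ w j, v w j = z ∧ (j : ℕ) = ℓ z := fun z => by
    obtain ⟨w, j, hz⟩ := hv z
    obtain ⟨⟨w', j'⟩, hm, he⟩ := Finset.exists_mem_eq_sup
      (Finset.univ.filter fun wj : Fin p × Fin (k + 1) => v wj.1 wj.2 = z) ⟨(w, j), by simpa using hz⟩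
      fun wj => (wj.2 : ℕ)
    exact ⟨w', j', by simpa using hm, he.symm⟩
  let A : Q → Prop := fun z => ∃ w, v w 0 = z
  let D : Q → Prop := fun z => ∃ w, v w (Fin.last k) = z
  let u : Q → ℝ := fun z => if A z then X else if D z then 1 else X * τ ^ ℓ z
  let g : Q → ℝ := fun z => if A z then 1 else if D z then Y else Y * τ ^ (k - ℓ z)
  have hpow : ∀ i, 1 ≤ τ ^ i := fun i => one_le_pow₀ hτ
  have hu1 : ∀ z, 1 ≤ u z := fun z => by
    simp only [u]; split_ifs
    · linarith
    · exact le_rfl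
    · nlinarith [hpow (ℓ z)]
  have hg1 : ∀ z, 1 ≤ g z := fun z => by
    simp only [g]; split_ifs
    · exact le_rfl
    · linarith
    · nlinarith [hpow (k - ℓ z)]
  have hIlt : ∀ z, ¬ D z → ℓ z < k := fun z hD => by
    obtain ⟨w, j, hz, hj⟩ := hex z
    rw [← hj]
    refine lt_of_le_of_ne (Nat.lt_succ_iff.1 j.2) fun hjk => hD ⟨w, ?_⟩
    rw [← hz]; congr 1; ext; simp [hjk]
  have hIpos : ∀ z, ¬ A z → 0 < ℓ z := fun z hA => by
    obtain ⟨w, j, hz, hj⟩ := hex z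
    rw [← hj]
    refine Nat.pos_of_ne_zero fun hj0 => hA ⟨w, ?_⟩
    rw [← hz]; congr 1; ext; simp [hj0]
  have hdug : ∀ z, labelCount v X Y n z = u z * g z := fun z => by
    simp only [labelCount, u, g, A, D]
    split_ifs with hA hD
    · ring
    · ring
    · have : τ ^ k = τ ^ ℓ z * τ ^ (k - ℓ z) := by
        rw [← pow_add]; congr 1; have := hIlt z hD; omega
      rw [← hn, this]; ring
  -- Edges taken out of their tail at its latest visit; only these pay for a tail that is not a
  -- starting vertex.
  let M : E → Prop := fun e => ∃ w j, ε (w, j) = e ∧ (j : ℕ) = ℓ (t e)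
  let F : E → ℝ := fun e => if A (t e) then X else if M e then u (t e) else 1
  have hF1 : ∀ e, 1 ≤ F e := fun e => by
    simp only [F]; split_ifs
    · exact hX
    · exact hu1 _
    · exact le_rfl
  have h1 : ∏ z, u z ≤ ∏ e, F e := by
    refine prod_le_prod_of_fiber t u _ hF1 (fun z => by linarith [hu1 z]) fun z => ?_
    by_cases hA : A z
    · right
      obtain ⟨w, hw⟩ := hA
      obtain ⟨j', -, hj'⟩ := exists_tail_eq ht (w := w) (j := 0)
          (by simpa [Fin.ext_iff] using hk.ne)
      refine ⟨_, hj'.trans hw, ?_⟩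
      have hA : A z := ⟨w, hw⟩
      have hAt : A (t (ε (w, j'))) := by rw [hj', hw]; exact hA
      simp only [F, u]
      rw [if_pos hAt, if_pos hA]
    · by_cases hD : D z
      · left; simp only [u]; rw [if_neg hA, if_pos hD]
      · right
        obtain ⟨w, j, hz, hj⟩ := hex z
        obtain ⟨j', hj1, hj'⟩ := exists_tail_eq ht (w := w) (j := j)
          (by rintro rfl; exact hD ⟨w, hz⟩)
        refine ⟨_, hj'.trans hz, ?_⟩
        have hM : M (ε (w, j')) := ⟨w, j', rfl, by rw [hj', hz, hj1, hj]⟩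
        have hAt : ¬ A (t (ε (w, j'))) := by rw [hj', hz]; exact hA
        simp only [F]
        rw [if_neg hAt, if_pos hM, hj', hz]
  have h2 : ∏ z, g z ≤ ∏ e, g (h e) := by
    refine prod_le_prod_of_fiber h g _ (fun e => hg1 _) (fun z => by linarith [hg1 z]) fun z => ?_
    obtain ⟨w, j, rfl⟩ := hv z
    by_cases hA : A (v w j)
    · left; simp only [g]; rw [if_pos hA]
    · have hj : j ≠ 0 := by rintro rfl; exact hA ⟨w, rfl⟩
      obtain ⟨e, he⟩ := exists_head_eq hh (w := w) hj
      exact Or.inr ⟨e, he, by rw [he]⟩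
  have hgle : ∀ z, g z ≤ Y * τ ^ (k - 1) := fun z => by
    simp only [g]; split_ifs with hA hD
    · nlinarith [hpow (k - 1)]
    · nlinarith [hpow (k - 1)]
    · refine mul_le_mul_of_nonneg_left (pow_le_pow_right₀ hτ ?_) (by linarith)
      have := hIpos z hA; omega
  have hFG : ∀ e, F e * g (h e) * τ ≤ n := fun e => by
    have hnk : n = X * (Y * τ ^ (k - 1)) * τ := by
      obtain ⟨k', rfl⟩ := Nat.exists_eq_succ_of_ne_zero hk.ne'
      rw [← hn]; simp; ring
    rw [hnk]
    refine mul_le_mul_of_nonneg_right ?_ (by linarith)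
    by_cases hA : A (t e)
    · simp only [F]; rw [if_pos hA]
      exact mul_le_mul_of_nonneg_left (hgle _) (by linarith)
    by_cases hM : M e
    · simp only [F]; rw [if_neg hA, if_pos hM]
      simp only [u]
      rw [if_neg hA]
      by_cases hD : D (t e)
      · rw [if_pos hD]
        exact mul_le_mul hX (hgle _) (by linarith [hg1 (h e)]) (by linarith)
      · rw [if_neg hD]
        obtain ⟨w, j, rfl, hj⟩ := hM
        -- The head is visited one step after the tail's latest position.
        have hb : ℓ (t (ε (w, j))) + 1 ≤ ℓ (h (ε (w, j))) := by
          have := hle w j.succ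
          rw [hh, ← hj]; simpa using this
        have hlt := hIlt _ hD
        rw [mul_assoc]
        refine mul_le_mul_of_nonneg_left ?_ (by linarith)
        have hτk : τ ^ ℓ (t (ε (w, j))) ≤ τ ^ (k - 1) := pow_le_pow_right₀ hτ (by omega)
        simp only [g]
        split_ifs with hA' hD'
        · nlinarith [hpow (k - 1)]
        · nlinarith
        · have hlt' := hIlt _ hD'
          calc τ ^ ℓ (t (ε (w, j))) * (Y * τ ^ (k - ℓ (h (ε (w, j)))))
              = Y * τ ^ (ℓ (t (ε (w, j))) + (k - ℓ (h (ε (w, j))))) := by rw [pow_add]; ring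
            _ ≤ _ := mul_le_mul_of_nonneg_left (pow_le_pow_right₀ hτ (by omega)) (by linarith)
    · simp only [F]; rw [if_neg hA, if_neg hM]
      exact mul_le_mul hX (hgle _) (by linarith [hg1 (h e)]) (by linarith)
  simp_rw [hdug]
  rw [Finset.prod_mul_distrib]
  calc (∏ z, u z) * (∏ z, g z) * τ ^ Fintype.card E
      ≤ (∏ e, F e) * (∏ e, g (h e)) * τ ^ Fintype.card E := by
        refine mul_le_mul_of_nonneg_right (mul_le_mul h1 h2
          (Finset.prod_nonneg fun z _ => by linarith [hg1 z])
          (Finset.prod_nonneg fun z _ => by linarith [hF1 z])) (by positivity)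
    _ = ∏ e, (F e * g (h e) * τ) := by
        rw [Finset.prod_mul_distrib, Finset.prod_mul_distrib]; simp
    _ ≤ ∏ _e : E, n := Finset.prod_le_prod (fun e _ => by
        have := hF1 e; have := hg1 (h e); positivity) fun e _ => hFG e
    _ = n ^ Fintype.card E := by simp

/-- Charging `X` to a leaving edge and `n / X` to an entering one covers every vertex except sinks,
which have no leaving edge and need an extra `X * Y / n`. Since every edge is traversed twice, a
sink ends at least two walks, so there are at most `p / 2` sinks. -/
theorem prod_labelCount_le_of_le_mul (hv : ∀ z, ∃ w j, v w j = z)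
    (ht : ∀ w j, t (ε (w, j)) = v w j.castSucc) (hh : ∀ w j, h (ε (w, j)) = v w j.succ)
    (hk : 0 < k) (hX : 1 ≤ X) (hXn : X ≤ n) (hY : 1 ≤ Y) (hYn : Y ≤ n)
    (hXY : n ≤ X * Y) {r : ℕ} (hr : p = 2 * r)
    (hε : ∀ s, ∃ s', s' ≠ s ∧ ε s' = ε s) :
    ∏ z, labelCount v X Y n z ≤ n ^ Fintype.card E * (X * Y / n) ^ r := by
  classical
  have hn : 1 ≤ n := hX.trans hXn
  have hq : 1 ≤ X * Y / n := by rw [le_div_iff₀ (by linarith)]; linarith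
  have hnX : 1 ≤ n / X := by rw [le_div_iff₀ (by linarith)]; linarith
  let T : Q → Prop := fun z => ∃ e, t e = z
  let u : Q → ℝ := fun z => if T z then X else 1
  let g : Q → ℝ := fun z => if ∃ e, h e = z then n / X else 1
  let b : Q → ℝ := fun z => if T z then 1 else X * Y / n
  have hu1 : ∀ z, 1 ≤ u z := fun z => by simp only [u]; split_ifs <;> linarith
  have hg1 : ∀ z, 1 ≤ g z := fun z => by simp only [g]; split_ifs <;> linarith
  have hb1 : ∀ z, 1 ≤ b z := fun z => by simp only [b]; split_ifs <;> linarith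
  have hApos : ∀ w, T (v w 0) := fun w => by
    obtain ⟨j', -, hj'⟩ := exists_tail_eq ht (w := w) (j := 0)
      (by simpa [Fin.ext_iff] using hk.ne)
    exact ⟨_, hj'⟩
  have hd : ∀ z, labelCount v X Y n z ≤ u z * g z * b z := fun z => by
    obtain ⟨w, j, rfl⟩ := hv z
    by_cases hA : ∃ w', v w' 0 = v w j
    · have hT : T (v w j) := by obtain ⟨w', hw'⟩ := hA; rw [← hw']; exact hApos w'
      simp only [labelCount, u, b]
      rw [if_pos hA, if_pos hT, if_pos hT]
      nlinarith [hg1 (v w j)]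
    · have hj : j ≠ 0 := by rintro rfl; exact hA ⟨w, rfl⟩
      have hH : ∃ e, h e = v w j := exists_head_eq hh hj
      have hX0 : X ≠ 0 := by linarith
      have hn0 : n ≠ 0 := by linarith
      by_cases hT : T (v w j)
      · have : u (v w j) * g (v w j) * b (v w j) = n := by
          simp only [u, g, b]; rw [if_pos hT, if_pos hH, if_pos hT]; field_simp
        rw [this]
        simp only [labelCount]
        split_ifs <;> linarith
      · have : u (v w j) * g (v w j) * b (v w j) = Y := by
          simp only [u, g, b]; rw [if_neg hT, if_pos hH, if_neg hT]; field_simp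
        rw [this]
        have hjl : j = Fin.last k := by
          by_contra hne
          obtain ⟨j', -, hj'⟩ := exists_tail_eq ht (w := w) hne
          exact hT ⟨_, hj'⟩
        simp only [labelCount]
        rw [if_neg hA, if_pos ⟨w, by rw [hjl]⟩]
  have h1 : ∏ z, u z ≤ ∏ _e : E, X := by
    refine prod_le_prod_of_fiber t u _ (fun _ => hX) (fun z => by linarith [hu1 z]) fun z => ?_
    by_cases hT : T z
    · obtain ⟨e, he⟩ := hT
      exact Or.inr ⟨e, he, by simp only [u]; split_ifs <;> linarith⟩
    · left; simp only [u]; rw [if_neg hT]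
  have h2 : ∏ z, g z ≤ ∏ _e : E, (n / X) := by
    refine prod_le_prod_of_fiber h g _ (fun _ => hnX) (fun z => by linarith [hg1 z]) fun z => ?_
    by_cases hH : ∃ e, h e = z
    · obtain ⟨e, he⟩ := hH
      exact Or.inr ⟨e, he, by simp only [g]; split_ifs <;> linarith⟩
    · left; simp only [g]; rw [if_neg hH]
  have hsink : (Finset.univ.filter fun z => ¬ T z).card * 2 ≤ p := by
    have := Finset.mul_card_image_le_card_of_maps_to
      (s := Finset.univ.filter fun w : Fin p => ¬ T (v w (Fin.last k)))
      (t := Finset.univ.filter fun z => ¬ T z) (f := fun w => v w (Fin.last k))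
      (by intro w hw; simpa using hw) 2 ?_
    · calc (Finset.univ.filter fun z => ¬ T z).card * 2 ≤ _ := (mul_comm _ _).le.trans this
        _ ≤ (Finset.univ : Finset (Fin p)).card := Finset.card_le_card (Finset.filter_subset _ _)
        _ = p := by simp
    · intro z hz
      have hz : ¬ T z := by simpa using hz
      obtain ⟨w, j, rfl⟩ := hv z
      have hlast : ∀ w' j', v w' j' = v w j → j' = Fin.last k := fun w' j' hw' => by
        by_contra hne
        obtain ⟨j'', -, hj'⟩ := exists_tail_eq ht (w := w') hne
        exact hz ⟨_, hj'.trans hw'⟩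
      obtain ⟨k', rfl⟩ := Nat.exists_eq_succ_of_ne_zero hk.ne'
      obtain ⟨⟨w', j'⟩, hne, he⟩ := hε (w, Fin.last k')
      have hj := hlast w j rfl
      have hs : v w' j'.succ = v w j := by
        rw [← hh, he, hh, hj, Fin.succ_last]
      have hj' := hlast w' _ hs
      have hj'' : j' = Fin.last k' := by
        rw [← Fin.succ_last] at hj'; exact Fin.succ_injective _ hj'
      -- Both traversals occur in the final step, so distinct steps mean distinct walks.
      have hww : w' ≠ w := by rintro rfl; exact hne (by rw [hj''])
      calc 2 = ({w', w} : Finset (Fin p)).card := by rw [Finset.card_pair hww]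
        _ ≤ _ := Finset.card_le_card fun a ha => by
          have hs' : v w' (Fin.last (k' + 1)) = v w j := by rw [← hj', hs]
          have hw0 : v w (Fin.last (k' + 1)) = v w j := by rw [hj]
          simp only [Finset.mem_insert, Finset.mem_singleton] at ha
          simp only [Finset.mem_filter, Finset.mem_univ, true_and]
          rcases ha with rfl | rfl
          · exact ⟨by rw [hs']; exact hz, hs'⟩
          · exact ⟨by rw [hw0]; exact hz, hw0⟩
  have h3 : ∏ z, b z ≤ (X * Y / n) ^ r := by
    have : ∏ z, b z = (X * Y / n) ^ (Finset.univ.filter fun z => ¬ T z).card := by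
      simp only [b]
      rw [Finset.prod_ite, Finset.prod_const_one, one_mul, Finset.prod_const]
    rw [this]
    exact pow_le_pow_right₀ hq (by omega)
  calc ∏ z, labelCount v X Y n z ≤ ∏ z, (u z * g z * b z) :=
        Finset.prod_le_prod (fun z _ => labelCount_nonneg (by linarith) (by linarith)
          (by linarith) z) fun z _ => hd z
    _ = (∏ z, u z) * (∏ z, g z) * ∏ z, b z := by
        rw [Finset.prod_mul_distrib, Finset.prod_mul_distrib]
    _ ≤ (∏ _e : E, X) * (∏ _e : E, (n / X)) * (X * Y / n) ^ r := by
        refine mul_le_mul (mul_le_mul h1 h2 (Finset.prod_nonneg fun z _ => by linarith [hg1 z])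
          (Finset.prod_nonneg fun z _ => by linarith)) h3
          (Finset.prod_nonneg fun z _ => by linarith [hb1 z])
          (mul_nonneg (Finset.prod_nonneg fun z _ => by linarith)
            (Finset.prod_nonneg fun z _ => by linarith))
    _ = n ^ Fintype.card E * (X * Y / n) ^ r := by
        rw [← Finset.prod_mul_distrib]
        have : X * (n / X) = n := by field_simp
        simp [this]

end Walks

/-! ### Counting walk families by pattern. -/

/-- The directed edge that the family of walks `Φ` traverses in step `s.2` of its walk `s.1`. -/
def walkEdge {p k : ℕ} {α : Type*} (Φ : Fin p → Fin (k + 1) → α) (s : Fin p × Fin k) : α × α :=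
  (Φ s.1 s.2.castSucc, Φ s.1 s.2.succ)

/-- `Q` is the set of walk positions modulo gluing the endpoints of each step to those of its
representative. A compatible family is constant on classes, hence determined by one label per class.
-/
theorem exists_card_le_prod_labelCount {p k n : ℕ} (ε : Fin p × Fin k → Fin p × Fin k)
    (A D : Finset (Fin n)) :
    ∃ (Q : Type) (_ : Fintype Q) (v : Fin p → Fin (k + 1) → Q), (∀ z, ∃ w j, v w j = z) ∧
      (∀ w j, v (ε (w, j)).1 (ε (w, j)).2.castSucc = v w j.castSucc) ∧
      (∀ w j, v (ε (w, j)).1 (ε (w, j)).2.succ = v w j.succ) ∧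
      ((Finset.univ.filter fun Φ : Fin p → Fin (k + 1) → Fin n =>
          (∀ w, Φ w 0 ∈ A) ∧ (∀ w, Φ w (Fin.last k) ∈ D) ∧
            ∀ s, walkEdge Φ (ε s) = walkEdge Φ s).card : ℝ) ≤
        ∏ z, labelCount v A.card D.card n z := by
  classical
  let rel : Fin p × Fin (k + 1) → Fin p × Fin (k + 1) → Prop := fun a b =>
    ∃ s, (a = ((ε s).1, (ε s).2.castSucc) ∧ b = (s.1, s.2.castSucc)) ∨
      (a = ((ε s).1, (ε s).2.succ) ∧ b = (s.1, s.2.succ))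
  let v : Fin p → Fin (k + 1) → Quot rel := fun w j => Quot.mk rel (w, j)
  have : Fintype (Quot rel) := Fintype.ofFinite _
  refine ⟨Quot rel, inferInstance, v, ?_, fun w j => Quot.sound ⟨(w, j), Or.inl ⟨rfl, rfl⟩⟩,
    fun w j => Quot.sound ⟨(w, j), Or.inr ⟨rfl, rfl⟩⟩, ?_⟩
  · intro z
    induction z using Quot.ind with
    | mk a => exact ⟨a.1, a.2, rfl⟩
  let S : Quot rel → Finset (Fin n) := fun z =>
    if ∃ w, v w 0 = z then A else if ∃ w, v w (Fin.last k) = z then D else Finset.univ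
  have hS : ∀ z, ((S z).card : ℝ) = labelCount v A.card D.card n z := fun z => by
    simp only [S, labelCount]
    split_ifs <;> simp
  simp_rw [← hS]
  rw [← Nat.cast_prod, ← Fintype.card_piFinset]
  refine Nat.cast_le.2 ?_
  let f : (Fin p → Fin (k + 1) → Fin n) → Quot rel → Fin n := fun Φ z => Φ z.out.1 z.out.2
  have hf : ∀ Φ : Fin p → Fin (k + 1) → Fin n, (∀ s, walkEdge Φ (ε s) = walkEdge Φ s) →
      ∀ w j, f Φ (v w j) = Φ w j := fun Φ hΦ w j => by
    have hl : ∀ a b, rel a b → Φ a.1 a.2 = Φ b.1 b.2 := by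
      rintro a b ⟨s, ⟨rfl, rfl⟩ | ⟨rfl, rfl⟩⟩
      · exact congrArg Prod.fst (hΦ s)
      · exact congrArg Prod.snd (hΦ s)
    exact congrArg (Quot.lift (fun a : Fin p × Fin (k + 1) => Φ a.1 a.2) hl)
      (Quot.out_eq (v w j))
  refine Finset.card_le_card_of_injOn f ?_ ?_
  · intro Φ hΦ
    simp only [Finset.coe_filter, Finset.mem_univ, true_and, Set.mem_ofPred_eq] at hΦ
    obtain ⟨hA, hD, hE⟩ := hΦ
    simp only [Finset.mem_coe, Fintype.mem_piFinset]
    intro z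
    simp only [S]
    split_ifs with h1 h2
    · obtain ⟨w, rfl⟩ := h1
      rw [hf Φ hE]; exact hA w
    · obtain ⟨w, rfl⟩ := h2
      rw [hf Φ hE]; exact hD w
    · simp
  · intro Φ hΦ Ψ hΨ h
    simp only [Finset.coe_filter, Finset.mem_univ, true_and, Set.mem_ofPred_eq] at hΦ hΨ
    funext w j
    rw [← hf Φ hΦ.2.2, h, hf Ψ hΨ.2.2]

theorem two_mul_card_image_le {S T : Type*} [Fintype S] [DecidableEq T] (f : S → T)
    (hf : ∀ s, ∃ s', s' ≠ s ∧ f s' = f s) :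
    2 * (Finset.univ.image f).card ≤ Fintype.card S := by
  classical
  refine Finset.mul_card_image_le_card Finset.univ 2 ?_
  intro b hb
  obtain ⟨s, -, rfl⟩ := Finset.mem_image.1 hb
  obtain ⟨s', hne, he⟩ := hf s
  rw [← Finset.card_pair hne]
  refine Finset.card_le_card fun a ha => ?_
  simp only [Finset.mem_insert, Finset.mem_singleton] at ha
  rcases ha with rfl | rfl <;> simp [he]

/-- For `q ≤ 1` and `m ≥ k`, take `τ = q ^ (-1 / k)`, so that `(ρ / τ) ^ k = ρ ^ k * q`. Since `m`
lies between `k` and `k * h`, the power `(ρ / τ) ^ m` is bounded by one at an endpoint. The other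
cases need only `ρ ≥ 1`. -/
theorem pow_mul_le_max {ρ q y : ℝ} {k h m : ℕ} {n : ℝ} (hn : 0 < n) (hρ : 1 ≤ ρ) (hq : 0 < q)
    (hk : 0 < k) (hm : m ≤ k * h)
    (h1 : 1 ≤ q → y ≤ n ^ m * q ^ h) (h2 : q ≤ 1 → y ≤ n ^ m * q)
    (h3 : ∀ τ : ℝ, 1 ≤ τ → τ ^ k * q = 1 → y * τ ^ m ≤ n ^ m) :
    y * ρ ^ m ≤ n ^ m * max ((ρ ^ k * q) ^ h) (ρ ^ k * q) := by
  have hρ0 : 0 < ρ := by linarith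
  rcases le_total 1 q with hq1 | hq1
  · calc y * ρ ^ m ≤ (n ^ m * q ^ h) * ρ ^ m := mul_le_mul_of_nonneg_right (h1 hq1) (by positivity)
      _ = n ^ m * (ρ ^ m * q ^ h) := by ring
      _ ≤ n ^ m * (ρ ^ (k * h) * q ^ h) := by gcongr
      _ = n ^ m * (ρ ^ k * q) ^ h := by rw [mul_pow, pow_mul]
      _ ≤ _ := mul_le_mul_of_nonneg_left (le_max_left _ _) (by positivity)
  rcases le_total m k with hmk | hmk
  · calc y * ρ ^ m ≤ (n ^ m * q) * ρ ^ m := mul_le_mul_of_nonneg_right (h2 hq1) (by positivity)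
      _ = n ^ m * (ρ ^ m * q) := by ring
      _ ≤ n ^ m * (ρ ^ k * q) := by gcongr
      _ ≤ _ := mul_le_mul_of_nonneg_left (le_max_right _ _) (by positivity)
  · let τ : ℝ := (q⁻¹) ^ ((k : ℝ)⁻¹)
    have hτ : τ ^ k = q⁻¹ := Real.rpow_inv_natCast_pow (by positivity) hk.ne'
    have hτ1 : 1 ≤ τ := Real.one_le_rpow ((one_le_inv₀ hq).2 hq1) (by positivity)
    have h3' := h3 τ hτ1 (by rw [hτ]; field_simp)
    have hτ0 : 0 < τ := by linarith
    have hk' : (ρ / τ) ^ k = ρ ^ k * q := by rw [div_pow, hτ]; field_simp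
    have hd : 0 < ρ / τ := by positivity
    have hle : (ρ / τ) ^ m ≤ max ((ρ ^ k * q) ^ h) (ρ ^ k * q) := by
      rw [← hk', ← pow_mul]
      rcases le_total 1 (ρ / τ) with h' | h'
      · exact le_max_of_le_left (pow_le_pow_right₀ h' hm)
      · exact le_max_of_le_right (pow_le_pow_of_le_one hd.le h' hmk)
    calc y * ρ ^ m = y * τ ^ m * (ρ / τ) ^ m := by rw [div_pow]; field_simp
      _ ≤ n ^ m * (ρ / τ) ^ m := mul_le_mul_of_nonneg_right h3' (by positivity)
      _ ≤ _ := mul_le_mul_of_nonneg_left hle (by positivity)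

theorem card_walks_mul_pow_le {p k n h : ℕ} (hk : 0 < k) (hh : 0 < h) (hp : p = 2 * h)
    (ε : Fin p × Fin k → Fin p × Fin k)
    (hε : ∀ s, ∃ s', s' ≠ s ∧ ε s' = ε s) (A D : Finset (Fin n)) (hA : A.Nonempty)
    (hD : D.Nonempty) {ρ : ℝ} (hρ : 1 ≤ ρ) :
    ((Finset.univ.filter fun Φ : Fin p → Fin (k + 1) → Fin n =>
        (∀ w, Φ w 0 ∈ A) ∧ (∀ w, Φ w (Fin.last k) ∈ D) ∧
          ∀ s, walkEdge Φ (ε s) = walkEdge Φ s).card : ℝ) * ρ ^ (Finset.univ.image ε).card ≤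
      (n : ℝ) ^ (Finset.univ.image ε).card *
        max ((ρ ^ k * (A.card * D.card / n)) ^ h) (ρ ^ k * (A.card * D.card / n)) := by
  classical
  obtain ⟨Q, _, v, hv, ht, hh', hcard⟩ := exists_card_le_prod_labelCount ε A D
  have hA1 : (1 : ℝ) ≤ A.card := by exact_mod_cast hA.card_pos
  have hD1 : (1 : ℝ) ≤ D.card := by exact_mod_cast hD.card_pos
  have hAn : (A.card : ℝ) ≤ n := by
    exact_mod_cast (Finset.card_le_univ A).trans (Fintype.card_fin n).le
  have hDn : (D.card : ℝ) ≤ n := by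
    exact_mod_cast (Finset.card_le_univ D).trans (Fintype.card_fin n).le
  have hn : (0 : ℝ) < n := by linarith
  have hm : (Finset.univ.image ε).card ≤ k * h := by
    have := two_mul_card_image_le ε hε
    simp only [Fintype.card_prod, Fintype.card_fin, hp] at this
    nlinarith
  let ε' : Fin p × Fin k → Finset.univ.image ε :=
    fun s => ⟨ε s, Finset.mem_image_of_mem _ (Finset.mem_univ s)⟩
  let t : Finset.univ.image ε → Q := fun e => v e.1.1 e.1.2.castSucc
  let hd : Finset.univ.image ε → Q := fun e => v e.1.1 e.1.2.succ
  have hE : Fintype.card (Finset.univ.image ε) = (Finset.univ.image ε).card :=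
    Fintype.card_coe _
  have hε' : ∀ s, ∃ s', s' ≠ s ∧ ε' s' = ε' s := fun s => by
    obtain ⟨s', hne, he⟩ := hε s
    exact ⟨s', hne, Subtype.ext he⟩
  refine pow_mul_le_max hn hρ (by positivity) hk hm (fun hq => ?_) (fun hq => ?_)
    fun τ hτ hτq => ?_
  · refine hcard.trans ?_
    rw [← hE]
    exact prod_labelCount_le_of_le_mul (ε := ε') (t := t) (h := hd) hv ht hh' hk hA1 hAn hD1 hDn
      (by rwa [one_le_div hn] at hq) hp hε'
  · refine hcard.trans ?_
    have := mul_prod_labelCount_le (ε := ε') (t := t) (h := hd) (n := (n : ℝ)) hv ht hh'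
      (by omega) hk hA1 hD1 (by rwa [div_le_one hn] at hq)
    rw [hE] at this
    rw [← mul_div_assoc, le_div_iff₀ hn]
    linarith
  · have := prod_labelCount_mul_pow_le (ε := ε') (t := t) (h := hd) (n := (n : ℝ)) hv ht hh' hk
      hA1 hD1 hτ (by field_simp at hτq; linarith)
    rw [hE] at this
    exact (mul_le_mul_of_nonneg_right hcard (by positivity)).trans this

/-- An idempotent with image `M` fixes `M` pointwise, so it is determined by its values off `M`.
Each of the `2 ^ |S|` possible images thus contributes at most `|S| ^ (|S| - |M|) * |S| ^ |M|`. -/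
theorem sum_idempotent_pow_card_image_le {S : Type*} [Fintype S] [DecidableEq S]
    (𝓔 : Finset (S → S)) (h𝓔 : ∀ ε ∈ 𝓔, ∀ s, ε (ε s) = ε s) :
    ∑ ε ∈ 𝓔, Fintype.card S ^ (Finset.univ.image ε).card ≤
      2 ^ Fintype.card S * Fintype.card S ^ Fintype.card S := by
  classical
  rw [← Finset.sum_fiberwise_of_maps_to (t := (Finset.univ : Finset (Finset S)))
    (g := fun ε : S → S => Finset.univ.image ε) (fun _ _ => Finset.mem_univ _)]
  have key : ∀ M : Finset S, ∑ ε ∈ 𝓔 with Finset.univ.image ε = M,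
      Fintype.card S ^ (Finset.univ.image ε).card ≤ Fintype.card S ^ Fintype.card S := fun M => by
    have h1 : (𝓔.filter fun ε => Finset.univ.image ε = M).card ≤
        Fintype.card ({s // s ∉ M} → S) := by
      rw [← Finset.card_univ]
      refine Finset.card_le_card_of_injOn (fun ε s => ε s.1) (fun _ _ => by simp) ?_
      intro ε₁ hε δ hδ h
      simp only [Finset.coe_filter, Set.mem_ofPred_eq] at hε hδ
      have hfix : ∀ ε ∈ 𝓔, Finset.univ.image ε = M → ∀ s ∈ M, ε s = s := by
        intro ε hε hM s hs
        rw [← hM] at hs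
        obtain ⟨s', -, rfl⟩ := Finset.mem_image.1 hs
        exact h𝓔 ε hε s'
      funext s
      by_cases hs : s ∈ M
      · rw [hfix ε₁ hε.1 hε.2 s hs, hfix δ hδ.1 hδ.2 s hs]
      · exact congrFun h ⟨s, hs⟩
    calc _ = ∑ ε ∈ 𝓔 with Finset.univ.image ε = M, Fintype.card S ^ M.card :=
          Finset.sum_congr rfl fun ε hε => by rw [(Finset.mem_filter.1 hε).2]
      _ ≤ Fintype.card S ^ (Fintype.card S - M.card) * Fintype.card S ^ M.card := by
          rw [Finset.sum_const, smul_eq_mul]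
          refine Nat.mul_le_mul_right _ (h1.trans ?_)
          rw [Fintype.card_fun]
          simp [Fintype.card_subtype_compl]
      _ = Fintype.card S ^ Fintype.card S := by
          rw [← pow_add, Nat.sub_add_cancel (Finset.card_le_univ M)]
  calc _ ≤ ∑ _M : Finset S, Fintype.card S ^ Fintype.card S := Finset.sum_le_sum fun M _ => key M
    _ = _ := by simp

theorem sum_walks_le {p k n h : ℕ} (hk : 0 < k) (hh : 0 < h) (hp : p = 2 * h)
    (A D : Finset (Fin n)) (hA : A.Nonempty) (hD : D.Nonempty) {σ B : ℝ} (hσ : 0 < σ) (hB : 0 < B)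
    (hσB : B ^ 2 * (k * p : ℕ) ≤ σ ^ 2 * n) :
    ∑ Φ : Fin p → Fin (k + 1) → Fin n with (∀ w, Φ w 0 ∈ A) ∧ (∀ w, Φ w (Fin.last k) ∈ D) ∧
        ∀ s, ∃ s', s' ≠ s ∧ walkEdge Φ s' = walkEdge Φ s,
      B ^ (k * p - 2 * (Finset.univ.image (walkEdge Φ)).card) *
        σ ^ (2 * (Finset.univ.image (walkEdge Φ)).card) ≤
    2 ^ (k * p) * ((k * p : ℕ) : ℝ) ^ (k * p) * (B ^ (k * p) *
      max (((σ ^ 2 * n / (B ^ 2 * (k * p : ℕ))) ^ k * (A.card * D.card / n)) ^ h)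
        ((σ ^ 2 * n / (B ^ 2 * (k * p : ℕ))) ^ k * (A.card * D.card / n))) := by
  classical
  set L := k * p with hL
  have hp0 : 0 < p := by omega
  have hL0 : 0 < L := Nat.mul_pos hk hp0
  have hL0' : (0 : ℝ) < L := by exact_mod_cast hL0
  set ρ : ℝ := σ ^ 2 * n / (B ^ 2 * L) with hρ
  set T := max ((ρ ^ k * (A.card * D.card / n : ℝ)) ^ h) (ρ ^ k * (A.card * D.card / n : ℝ))
    with hT
  have hn : (0 : ℝ) < n := by
    obtain ⟨a, -⟩ := hA
    exact_mod_cast Fin.pos a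
  have hρ1 : 1 ≤ ρ := by rw [hρ, one_le_div (by positivity)]; exact hσB
  have hT0 : 0 ≤ T := le_max_of_le_right (by positivity)
  have : Nonempty (Fin p × Fin k) := ⟨(⟨0, hp0⟩, ⟨0, hk⟩)⟩
  have hS : Fintype.card (Fin p × Fin k) = L := by simp [hL, mul_comm]
  -- The pattern of `Φ`: the chosen representative depends only on the edge, which makes the map
  -- idempotent.
  let c : (Fin p → Fin (k + 1) → Fin n) → Fin p × Fin k → Fin p × Fin k :=
    fun Φ s => Function.invFun (walkEdge Φ) (walkEdge Φ s)
  have hc : ∀ Φ s, walkEdge Φ (c Φ s) = walkEdge Φ s := fun Φ s =>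
    Function.invFun_eq ⟨s, rfl⟩
  have hc' : ∀ Φ s s', walkEdge Φ s = walkEdge Φ s' → c Φ s = c Φ s' := fun Φ s s' he => by
    simp only [c]; rw [he]
  have hcard : ∀ Φ, (Finset.univ.image (walkEdge Φ)).card = (Finset.univ.image (c Φ)).card := by
    intro Φ
    have : Finset.univ.image (walkEdge Φ) = (Finset.univ.image (c Φ)).image (walkEdge Φ) := by
      rw [Finset.image_image]
      congr 1
      funext s; exact (hc Φ s).symm
    rw [this, Finset.card_image_of_injOn]
    intro a ha b hb hab
    obtain ⟨a, -, rfl⟩ := Finset.mem_image.1 (Finset.mem_coe.1 ha)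
    obtain ⟨b, -, rfl⟩ := Finset.mem_image.1 (Finset.mem_coe.1 hb)
    rw [hc, hc] at hab
    exact hc' Φ _ _ hab
  let 𝓔 : Finset (Fin p × Fin k → Fin p × Fin k) := Finset.univ.filter fun ε =>
    (∀ s, ε (ε s) = ε s) ∧ ∀ s, ∃ s', s' ≠ s ∧ ε s' = ε s
  rw [← Finset.sum_fiberwise_of_maps_to (t := 𝓔) (g := c)]
  swap
  · intro Φ hΦ
    simp only [Finset.mem_filter, Finset.mem_univ, true_and] at hΦ
    simp only [𝓔, Finset.mem_filter, Finset.mem_univ, true_and]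
    refine ⟨fun s => hc' Φ _ _ (hc Φ s), fun s => ?_⟩
    obtain ⟨s', hne, he⟩ := hΦ.2.2 s
    exact ⟨s', hne, hc' Φ _ _ he⟩
  have key : ∀ ε ∈ 𝓔, ∑ Φ ∈ (Finset.univ.filter fun Φ : Fin p → Fin (k + 1) → Fin n =>
        (∀ w, Φ w 0 ∈ A) ∧ (∀ w, Φ w (Fin.last k) ∈ D) ∧
        ∀ s, ∃ s', s' ≠ s ∧ walkEdge Φ s' = walkEdge Φ s) with c Φ = ε,
      B ^ (L - 2 * (Finset.univ.image (walkEdge Φ)).card) *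
        σ ^ (2 * (Finset.univ.image (walkEdge Φ)).card) ≤
      ((L ^ (Finset.univ.image ε).card : ℕ) : ℝ) * (B ^ L * T) := by
    intro ε hε
    simp only [𝓔, Finset.mem_filter, Finset.mem_univ, true_and] at hε
    have hmain := card_walks_mul_pow_le hk hh hp ε hε.2 A D hA hD hρ1
    set m := (Finset.univ.image ε).card with hm
    have hmL : 2 * m ≤ L := hS ▸ two_mul_card_image_le ε hε.2
    rw [Finset.sum_congr rfl (g := fun _ => B ^ (L - 2 * m) * σ ^ (2 * m))]
    swap
    · intro Φ hΦ
      rw [hcard, (Finset.mem_filter.1 hΦ).2]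
    rw [Finset.sum_const, nsmul_eq_mul]
    -- This identity dictates the choice of `ρ`: trading `σ²` for `B²` costs `ρ * L / n` per edge.
    have hw : B ^ (L - 2 * m) * σ ^ (2 * m) * n ^ m = L ^ m * B ^ L * ρ ^ m := by
      have : B ^ L = B ^ (L - 2 * m) * B ^ (2 * m) := by rw [← pow_add, Nat.sub_add_cancel hmL]
      rw [this, hρ, div_pow, mul_pow, mul_pow]
      field_simp
      ring
    have hle : ((Finset.filter (fun Φ => c Φ = ε) (Finset.univ.filter fun Φ :
        Fin p → Fin (k + 1) → Fin n => (∀ w, Φ w 0 ∈ A) ∧ (∀ w, Φ w (Fin.last k) ∈ D) ∧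
        ∀ s, ∃ s', s' ≠ s ∧ walkEdge Φ s' = walkEdge Φ s)).card : ℝ) ≤
        ((Finset.univ.filter fun Φ : Fin p → Fin (k + 1) → Fin n =>
        (∀ w, Φ w 0 ∈ A) ∧ (∀ w, Φ w (Fin.last k) ∈ D) ∧
          ∀ s, walkEdge Φ (ε s) = walkEdge Φ s).card : ℝ) := by
      refine Nat.cast_le.2 (Finset.card_le_card fun Φ hΦ => ?_)
      simp only [Finset.mem_filter, Finset.mem_univ, true_and] at hΦ ⊢
      refine ⟨hΦ.1.1, hΦ.1.2.1, fun s => ?_⟩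
      rw [← hΦ.2]; exact hc Φ s
    refine (mul_le_mul_of_nonneg_right hle (by positivity)).trans ?_
    refine le_of_mul_le_mul_right ?_ (pow_pos hn m)
    rw [mul_assoc, hw]
    calc _ = _ * ρ ^ m * (L ^ m * B ^ L) := by ring
      _ ≤ _ := mul_le_mul_of_nonneg_right hmain (by positivity)
      _ = _ := by push_cast; ring
  refine (Finset.sum_le_sum key).trans ?_
  rw [← Finset.sum_mul]
  refine mul_le_mul_of_nonneg_right ?_ (by positivity)
  have := sum_idempotent_pow_card_image_le 𝓔 fun ε hε => (Finset.mem_filter.1 hε).2.1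
  rw [hS] at this
  exact_mod_cast this

/-! ### Moments: walk expansion, independence and centering. -/

theorem dotProduct_pow_mulVec_eq_sum {n : ℕ} (M : Matrix (Fin n) (Fin n) ℝ) (k : ℕ)
    (x y : Fin n → ℝ) :
    x ⬝ᵥ ((M ^ k).mulVec y) = ∑ f : Fin (k + 1) → Fin n,
      x (f 0) * (∏ j : Fin k, M (f j.castSucc) (f j.succ)) * y (f (Fin.last k)) := by
  induction k generalizing x with
  | zero =>
    rw [← Equiv.sum_comp (Equiv.funUnique (Fin 1) (Fin n)).symm]
    simp [dotProduct]
  | succ k ih =>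
    rw [pow_succ', ← Matrix.mulVec_mulVec, Matrix.dotProduct_mulVec, ih,
      ← Equiv.sum_comp (Fin.consEquiv fun _ : Fin (k + 2) => Fin n), Fintype.sum_prod_type_right]
    refine Fintype.sum_congr _ _ fun g => ?_
    simp only [Matrix.vecMul, dotProduct, Finset.sum_mul, Fin.consEquiv_apply]
    refine Finset.sum_congr rfl fun i _ => ?_
    simp only [Fin.prod_univ_succ, Fin.cons_zero, Fin.castSucc_zero,
      Fin.cons_succ, ← Fin.succ_castSucc, ← Fin.succ_last]
    ring

section Moments

variable {Ω : Type*} [MeasurableSpace Ω] {P : Measure Ω} [IsProbabilityMeasure P]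

theorem abs_integral_pow_le {X : Ω → ℝ} {σ B : ℝ} (hX : Measurable X)
    (hmean : ∫ ω, X ω ∂P = 0) (hvar : variance X P ≤ σ ^ 2) (hB : ∀ᵐ ω ∂P, |X ω| ≤ B)
    (hB0 : 0 ≤ B) {μ : ℕ} (hμ : 2 ≤ μ) : |∫ ω, X ω ^ μ ∂P| ≤ B ^ (μ - 2) * σ ^ 2 := by
  have hint : Integrable (fun ω => B ^ (μ - 2) * X ω ^ 2) P := by
    refine (memLp_one_iff_integrable.1 (MemLp.of_bound (by fun_prop) (B ^ 2) ?_)).const_mul _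
    filter_upwards [hB] with ω hω
    rw [Real.norm_eq_abs, abs_pow]
    exact pow_le_pow_left₀ (abs_nonneg _) hω 2
  calc |∫ ω, X ω ^ μ ∂P| ≤ ∫ ω, B ^ (μ - 2) * X ω ^ 2 ∂P := by
        rw [← Real.norm_eq_abs]
        refine norm_integral_le_of_norm_le hint ?_
        filter_upwards [hB] with ω hω
        rw [Real.norm_eq_abs, abs_pow, ← sq_abs (X ω), ← Nat.sub_add_cancel hμ, pow_add,
          Nat.add_sub_cancel]
        exact mul_le_mul_of_nonneg_right (pow_le_pow_left₀ (abs_nonneg _) hω _) (by positivity)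
    _ = B ^ (μ - 2) * variance X P := by
        rw [integral_const_mul, variance_of_integral_eq_zero hX.aemeasurable hmean]
    _ ≤ _ := mul_le_mul_of_nonneg_left hvar (by positivity)

-- Independence factors the expectation by edge multiplicity. Multiplicity one gives a zero mean;
-- multiplicity `μ ≥ 2` gives at most `B ^ (μ - 2) * σ ^ 2`.
open Classical in
theorem abs_integral_prod_le {ι S : Type*} [Fintype ι] [DecidableEq ι] [Fintype S]
    {X : ι → Ω → ℝ} {σ B : ℝ} (hX : ∀ i, Measurable (X i)) (hind : iIndepFun X P)
    (hmean : ∀ i, ∫ ω, X i ω ∂P = 0) (hvar : ∀ i, variance (X i) P ≤ σ ^ 2)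
    (hB : ∀ i, ∀ᵐ ω ∂P, |X i ω| ≤ B) (hB0 : 0 ≤ B) (e : S → ι) :
    |∫ ω, ∏ s, X (e s) ω ∂P| ≤ if ∀ s, ∃ s', s' ≠ s ∧ e s' = e s then
      B ^ (Fintype.card S - 2 * (Finset.univ.image e).card) *
        σ ^ (2 * (Finset.univ.image e).card) else 0 := by
  let μ : ι → ℕ := fun i => (Finset.univ.filter fun s => e s = i).card
  have hprod : ∀ ω, ∏ s, X (e s) ω = ∏ i, X i ω ^ μ i := fun ω => by
    rw [← Finset.prod_fiberwise Finset.univ e]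
    refine Finset.prod_congr rfl fun i _ => ?_
    rw [Finset.prod_congr rfl (g := fun _ => X i ω), Finset.prod_const]
    intro s hs
    rw [(Finset.mem_filter.1 hs).2]
  have hint : ∫ ω, ∏ s, X (e s) ω ∂P = ∏ i, ∫ ω, X i ω ^ μ i ∂P := by
    simp_rw [hprod]
    exact (hind.comp (fun i a => a ^ μ i) fun i => by fun_prop).integral_fun_prod_eq_prod_integral
      fun i => ((hX i).pow_const _).aestronglyMeasurable
  rw [hint, Finset.abs_prod]
  split_ifs with h
  · have hμ2 : ∀ i ∈ Finset.univ.image e, 2 ≤ μ i := fun i hi => by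
      obtain ⟨s, -, rfl⟩ := Finset.mem_image.1 hi
      obtain ⟨s', hne, he⟩ := h s
      rw [← Finset.card_pair hne]
      refine Finset.card_le_card fun a ha => ?_
      simp only [Finset.mem_insert, Finset.mem_singleton] at ha
      rcases ha with rfl | rfl <;> simp [he]
    have hsum : ∑ i ∈ Finset.univ.image e, (μ i - 2) =
        Fintype.card S - 2 * (Finset.univ.image e).card := by
      rw [Finset.sum_tsub_distrib _ hμ2, ← Finset.card_univ,
        Finset.card_eq_sum_card_image e Finset.univ, Finset.sum_const, smul_eq_mul, mul_comm]
    calc ∏ i, |∫ ω, X i ω ^ μ i ∂P| = ∏ i ∈ Finset.univ.image e, |∫ ω, X i ω ^ μ i ∂P| := by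
          refine (Finset.prod_subset (Finset.subset_univ _) fun i _ hi => ?_).symm
          have : μ i = 0 := by
            refine Finset.card_eq_zero.2 (Finset.filter_eq_empty_iff.2 fun s _ hs => hi ?_)
            rw [← hs]
            exact Finset.mem_image_of_mem _ (Finset.mem_univ s)
          simp [this]
      _ ≤ ∏ i ∈ Finset.univ.image e, B ^ (μ i - 2) * σ ^ 2 :=
          Finset.prod_le_prod (fun _ _ => abs_nonneg _) fun i hi =>
            abs_integral_pow_le (hX i) (hmean i) (hvar i) (hB i) hB0 (hμ2 i hi)
      _ = _ := by
          rw [Finset.prod_mul_distrib, Finset.prod_pow_eq_pow_sum, hsum, Finset.prod_const,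
            ← pow_mul]
  · push Not at h
    obtain ⟨s, hs⟩ := h
    refine (Finset.prod_eq_zero (Finset.mem_univ (e s)) ?_).le
    have : μ (e s) = 1 := by
      refine Finset.card_eq_one.2 ⟨s, ?_⟩
      ext s'
      simp only [Finset.mem_filter, Finset.mem_univ, true_and, Finset.mem_singleton]
      exact ⟨fun he => by_contra fun hne => hs s' hne he, fun he => by rw [he]⟩
    simp [this, hmean]

/-- Convexity of the even power separates `X` from its mean, and Jensen bounds the mean's power by
the raw moment. -/
theorem centralMoment_le_two_pow_mul {X : Ω → ℝ} {p : ℕ} (hp : Even p) (hp0 : p ≠ 0)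
    (hX : MemLp X p P) : centralMoment X p P ≤ 2 ^ p * ∫ ω, X ω ^ p ∂P := by
  have hpow : ∀ a : ℝ, ‖a‖ ^ p = a ^ p := fun a => by rw [Real.norm_eq_abs, hp.pow_abs]
  have hXp : Integrable (fun ω => X ω ^ p) P := by
    simpa only [hpow] using hX.integrable_norm_pow hp0
  have hXi : Integrable X P :=
    hX.integrable (by exact_mod_cast Nat.one_le_iff_ne_zero.2 hp0)
  have hXc : Integrable (fun ω => (X ω - ∫ ω, X ω ∂P) ^ p) P := by
    have := (hX.sub (memLp_const (∫ ω, X ω ∂P))).integrable_norm_pow hp0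
    simpa only [hpow, Pi.sub_apply] using this
  have hJ : (∫ ω, X ω ∂P) ^ p ≤ ∫ ω, X ω ^ p ∂P :=
    hp.convexOn_pow.map_integral_le (g := fun a : ℝ => a ^ p) (by fun_prop) isClosed_univ
      (by simp) hXi hXp
  have h2 : (2 : ℝ) ^ p = 2 ^ (p - 1) * 2 := by
    rw [← pow_succ, Nat.sub_add_cancel (Nat.one_le_iff_ne_zero.2 hp0)]
  calc centralMoment X p P = ∫ ω, (X ω - ∫ ω, X ω ∂P) ^ p ∂P := rfl
    _ ≤ ∫ ω, 2 ^ (p - 1) * (X ω ^ p + (∫ ω, X ω ∂P) ^ p) ∂P := by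
        refine integral_mono hXc ((hXp.add (integrable_const _)).const_mul _) fun ω => ?_
        have := hp.add_pow_le (a := X ω) (b := -∫ ω, X ω ∂P)
        rwa [hp.neg_pow, ← sub_eq_add_neg] at this
    _ = 2 ^ (p - 1) * (∫ ω, X ω ^ p ∂P + (∫ ω, X ω ∂P) ^ p) := by
        rw [integral_const_mul, integral_add hXp (integrable_const _)]; simp
    _ ≤ 2 ^ (p - 1) * (∫ ω, X ω ^ p ∂P + ∫ ω, X ω ^ p ∂P) := by gcongr
    _ = 2 ^ p * ∫ ω, X ω ^ p ∂P := by rw [h2]; ring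

variable {n k : ℕ} {H : Ω → Matrix (Fin n) (Fin n) ℝ} {σ B : ℝ}

namespace IsBoundedSymmetricNoise

theorem memLp_powerForm (hH : IsBoundedSymmetricNoise P H σ B) (x y : Fin n → ℝ) (p : ENNReal) :
    MemLp (powerForm H k x y) p P := by
  have hm := hH.measurable_entry
  have hae : ∀ᵐ ω ∂P, ∀ i j, |H ω i j| ≤ B :=
    ae_all_iff.2 fun i => ae_all_iff.2 fun j => hH.abs_le i j
  have heq : powerForm H k x y = fun ω => ∑ f : Fin (k + 1) → Fin n,
      x (f 0) * (∏ j : Fin k, H ω (f j.castSucc) (f j.succ)) * y (f (Fin.last k)) :=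
    funext fun ω => dotProduct_pow_mulVec_eq_sum _ _ _ _
  rw [heq]
  refine MemLp.of_bound (by fun_prop)
    (∑ f : Fin (k + 1) → Fin n, |x (f 0)| * (∏ _j : Fin k, B) * |y (f (Fin.last k))|) ?_
  filter_upwards [hae] with ω hω
  refine (norm_sum_le _ _).trans (Finset.sum_le_sum fun f _ => ?_)
  rw [Real.norm_eq_abs, abs_mul, abs_mul, Finset.abs_prod]
  gcongr
  exact hω _ _

open Classical in
theorem integral_powerForm_pow_le (hH : IsBoundedSymmetricNoise P H σ B) (hB : 0 ≤ B)
    (x y : Fin n → ℝ) (p : ℕ) :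
    ∫ ω, powerForm H k x y ω ^ p ∂P ≤ (‖x‖ * ‖y‖) ^ p *
      ∑ Φ : Fin p → Fin (k + 1) → Fin n with
          (∀ w, Φ w 0 ∈ Finset.univ.filter fun i => x i ≠ 0) ∧
          (∀ w, Φ w (Fin.last k) ∈ Finset.univ.filter fun i => y i ≠ 0) ∧
          ∀ s, ∃ s', s' ≠ s ∧ walkEdge Φ s' = walkEdge Φ s,
        B ^ (k * p - 2 * (Finset.univ.image (walkEdge Φ)).card) *
          σ ^ (2 * (Finset.univ.image (walkEdge Φ)).card) := by
  have hm := hH.measurable_entry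
  have hae : ∀ᵐ ω ∂P, ∀ i j, |H ω i j| ≤ B :=
    ae_all_iff.2 fun i => ae_all_iff.2 fun j => hH.abs_le i j
  let X : Fin n × Fin n → Ω → ℝ := fun ij ω => H ω ij.1 ij.2
  let a : (Fin p → Fin (k + 1) → Fin n) → ℝ := fun Φ => ∏ w, (x (Φ w 0) * y (Φ w (Fin.last k)))
  have heq : ∀ ω, powerForm H k x y ω ^ p =
      ∑ Φ : Fin p → Fin (k + 1) → Fin n, a Φ * ∏ s, X (walkEdge Φ s) ω := fun ω => by
    rw [powerForm, dotProduct_pow_mulVec_eq_sum, Fintype.sum_pow]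
    refine Finset.sum_congr rfl fun Φ _ => ?_
    rw [Fintype.prod_prod_type, ← Finset.prod_mul_distrib]
    refine Finset.prod_congr rfl fun w _ => ?_
    simp only [walkEdge, X]
    ring
  have hint : ∀ Φ : Fin p → Fin (k + 1) → Fin n,
      Integrable (fun ω => ∏ s, X (walkEdge Φ s) ω) P := fun Φ => by
    refine memLp_one_iff_integrable.1 (MemLp.of_bound ?_ (∏ _s : Fin p × Fin k, B) ?_)
    · simp only [X]; fun_prop
    · filter_upwards [hae] with ω hω
      rw [Real.norm_eq_abs, Finset.abs_prod]
      exact Finset.prod_le_prod (fun _ _ => abs_nonneg _) fun s _ => hω _ _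
  simp_rw [heq]
  rw [integral_finsetSum _ fun Φ _ => (hint Φ).const_mul _, Finset.mul_sum, Finset.sum_filter]
  refine Finset.sum_le_sum fun Φ _ => ?_
  rw [integral_const_mul]
  have hE := abs_integral_prod_le (P := P) (X := X) (fun i => hm _ _) hH.indep
    (fun i => hH.mean_zero _ _) (fun i => hH.variance_le _ _) (fun i => hH.abs_le _ _) hB
    (walkEdge Φ)
  rw [Fintype.card_prod, Fintype.card_fin, Fintype.card_fin, mul_comm p k] at hE
  have ha : |a Φ| ≤ (‖x‖ * ‖y‖) ^ p := by
    calc |a Φ| = ∏ w, |x (Φ w 0) * y (Φ w (Fin.last k))| := Finset.abs_prod _ _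
      _ ≤ ∏ _w : Fin p, ‖x‖ * ‖y‖ := Finset.prod_le_prod (fun _ _ => abs_nonneg _) fun w _ => by
          rw [abs_mul]
          exact mul_le_mul (norm_le_pi_norm x _) (norm_le_pi_norm y _) (abs_nonneg _)
            (norm_nonneg _)
      _ = _ := by simp
  split_ifs with h
  · rw [if_pos h.2.2] at hE
    calc a Φ * _ ≤ |a Φ| * _ := (le_abs_self _).trans (abs_mul _ _).le
      _ ≤ _ := mul_le_mul ha hE (abs_nonneg _) (by positivity)
  · by_cases h3 : ∀ s, ∃ s', s' ≠ s ∧ walkEdge Φ s' = walkEdge Φ s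
    · have : a Φ = 0 := by
        by_contra ha0
        refine h ⟨fun w => ?_, fun w => ?_, h3⟩
        · have := (mul_ne_zero_iff.1 (Finset.prod_ne_zero_iff.1 ha0 w (Finset.mem_univ w))).1
          simpa using this
        · have := (mul_ne_zero_iff.1 (Finset.prod_ne_zero_iff.1 ha0 w (Finset.mem_univ w))).2
          simpa using this
      rw [this, zero_mul]
    · rw [if_neg h3] at hE
      rw [abs_nonpos_iff.1 hE, mul_zero]

end IsBoundedSymmetricNoise

end Moments

/-! ### Matching the stated bound and conclusion. -/

theorem momentBound_nonneg {n : ℕ} {σ B : ℝ} (hσ : 0 < σ) (k p : ℕ)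
    (x y : Fin n → ℝ) : 0 ≤ momentBound σ B k p x y := by
  unfold momentBound
  exact mul_nonneg (by positivity) (le_max_of_le_left (by positivity))

theorem two_pow_mul_le_momentBound {n : ℕ} {σ B : ℝ} (hB : 0 < B) (hn : 0 < n) {k p h : ℕ}
    (hσ : 0 < σ) (hk : 0 < k) (hh : 0 < h) (hp : p = 2 * h) (x y : Fin n → ℝ) :
    2 ^ p * ((‖x‖ * ‖y‖) ^ p * (2 ^ (k * p) * ((k * p : ℕ) : ℝ) ^ (k * p) * (B ^ (k * p) *
      max (((σ ^ 2 * n / (B ^ 2 * (k * p : ℕ))) ^ k * (hammingNorm x * hammingNorm y / n)) ^ h)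
        ((σ ^ 2 * n / (B ^ 2 * (k * p : ℕ))) ^ k * (hammingNorm x * hammingNorm y / n))))) ≤
    momentBound σ B k p x y := by
  have hn' : (0 : ℝ) < n := by exact_mod_cast hn
  have hL : 0 < k * p := Nat.mul_pos hk (by omega)
  have hL' : (0 : ℝ) < (k * p : ℕ) := by exact_mod_cast hL
  have hp1 : (1 : ℝ) ≤ p := by exact_mod_cast (by omega : 1 ≤ p)
  have e1 : k * p / 2 = k * h := by
    rw [hp, show k * (2 * h) = k * h * 2 by ring, Nat.mul_div_cancel _ two_pos]
  have e2 : p / 2 = h := by omega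
  have e3 : k * p = 2 * (k * h) := by rw [hp]; ring
  unfold momentBound
  rw [e1, e2, mul_max_of_nonneg _ _ (by positivity : 0 ≤ B ^ (k * p))]
  generalize hLr : ((k * p : ℕ) : ℝ) = L at *
  have t1 : B ^ (k * p) * ((σ ^ 2 * n / (B ^ 2 * L)) ^ k *
      (hammingNorm x * hammingNorm y / n)) ^ h =
      σ ^ (k * p) * (n : ℝ) ^ (k * h) * ((hammingNorm x : ℝ) * hammingNorm y) ^ h /
        ((n : ℝ) ^ h * L ^ (k * h)) := by
    rw [e3]
    simp only [mul_pow, div_pow, ← pow_mul]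
    rw [show 2 * k * h = 2 * (k * h) by ring]
    field_simp
  have t2 : B ^ (k * p) * ((σ ^ 2 * n / (B ^ 2 * L)) ^ k *
      (hammingNorm x * hammingNorm y / n)) =
      B ^ (p * k) * σ ^ (2 * k) * (n : ℝ) ^ k * hammingNorm x * hammingNorm y /
        (B ^ (2 * k) * n * L ^ k) := by
    rw [mul_comm p k]
    simp only [mul_pow, div_pow, ← pow_mul]
    field_simp
  rw [t1, t2]
  set T := max (σ ^ (k * p) * (n : ℝ) ^ (k * h) * ((hammingNorm x : ℝ) * hammingNorm y) ^ h /
        ((n : ℝ) ^ h * L ^ (k * h))) (B ^ (p * k) * σ ^ (2 * k) * (n : ℝ) ^ k * hammingNorm x *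
        hammingNorm y / (B ^ (2 * k) * n * L ^ k))
  have hT : 0 ≤ T := le_max_of_le_right (by positivity)
  have hR : 0 ≤ 2 ^ ((k + 1) * p) * L ^ (k * p) * (‖x‖ * ‖y‖) ^ p * T := by positivity
  -- The factor `p` of `momentBound` is spare: only `p ≥ 1` is needed.
  calc _ = (2 ^ ((k + 1) * p) * L ^ (k * p) * (‖x‖ * ‖y‖) ^ p * T) * 1 := by
        rw [add_mul, pow_add, one_mul]; ring
    _ ≤ (2 ^ ((k + 1) * p) * L ^ (k * p) * (‖x‖ * ‖y‖) ^ p * T) * p :=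
        mul_le_mul_of_nonneg_left hp1 hR
    _ = _ := by ring

theorem theorem2 :
    ∃ C : ℝ, 0 < C ∧
      ∀ σ B : ℕ → ℝ, (∀ n, 0 < σ n) → (∀ n, 0 < B n) →
        B =o[atTop] (fun n : ℕ => σ n * √((n : ℝ) / Real.log n ^ 3)) →
        ∃ N : ℕ, ∀ n : ℕ, N ≤ n →
          ∀ (Ω : Type*) [MeasurableSpace Ω] (P : Measure Ω) [IsProbabilityMeasure P]
            (H : Ω → Matrix (Fin n) (Fin n) ℝ), IsBoundedSymmetricNoise P H (σ n) (B n) →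
          ∀ (x y : Fin n → ℝ) (k p : ℕ), 2 ≤ k → 2 ≤ p → Even p →
            ((k * p : ℕ) : ℝ) ≤ Real.log n ^ 3 →
            MemLp (powerForm H k x y) p P ∧
              centralMoment (powerForm H k x y) p P ≤
                C * momentBound (σ n) (B n) k p x y := by
  classical
  refine ⟨1, one_pos, fun σ B hσ hB ho => ?_⟩
  -- Little-o is used only with constant one.
  obtain ⟨N, hN⟩ := eventually_atTop.1 (ho.bound one_pos)
  refine ⟨N, fun n hn Ω _ P _ H hH x y k p hk hp hpe hkp => ?_⟩
  have hmem := hH.memLp_powerForm (k := k) x y (p : ENNReal)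
  refine ⟨hmem, ?_⟩
  rw [one_mul]
  obtain ⟨h, rfl⟩ := hpe.two_dvd
  have hlog : 0 < Real.log n ^ 3 :=
    lt_of_lt_of_le (by exact_mod_cast Nat.mul_pos (by omega : 0 < k) (by omega)) hkp
  have hn0 : 0 < n := Nat.pos_of_ne_zero fun h0 => by simp [h0] at hlog
  -- Squaring the bound on `B n` gives `B² log³ n ≤ σ² n`, which with `k * p ≤ log³ n` is `ρ ≥ 1`.
  have hσB : B n ^ 2 * (k * (2 * h) : ℕ) ≤ σ n ^ 2 * n := by
    have h1 := hN n hn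
    rw [one_mul, Real.norm_of_nonneg (hB n).le,
      Real.norm_of_nonneg (mul_nonneg (hσ n).le (Real.sqrt_nonneg _))] at h1
    have h2 := pow_le_pow_left₀ (hB n).le h1 2
    rw [mul_pow, Real.sq_sqrt (by positivity), ← mul_div_assoc, le_div_iff₀ hlog] at h2
    exact (mul_le_mul_of_nonneg_left hkp (by positivity)).trans h2
  refine (centralMoment_le_two_pow_mul hpe (by omega) hmem).trans ?_
  have hint := hH.integral_powerForm_pow_le (k := k) (hB n).le x y (2 * h)
  -- The walk count needs nonempty supports; otherwise the raw moment is already at most zero.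
  by_cases hxy : x = 0 ∨ y = 0
  · have h0 : (‖x‖ * ‖y‖) ^ (2 * h) = 0 := by
      rw [pow_eq_zero_iff (by omega)]
      rcases hxy with rfl | rfl <;> simp
    rw [h0, zero_mul] at hint
    exact (mul_nonpos_of_nonneg_of_nonpos (by positivity) hint).trans
      (momentBound_nonneg (hσ n) _ _ _ _)
  · push Not at hxy
    have hne : ∀ z : Fin n → ℝ, z ≠ 0 → (Finset.univ.filter fun i => z i ≠ 0).Nonempty :=
      fun z hz => by
        obtain ⟨i, hi⟩ := Function.ne_iff.1 hz
        exact ⟨i, by simpa using hi⟩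
    have hsum := sum_walks_le (k := k) (by omega) (by omega) rfl _ _ (hne x hxy.1) (hne y hxy.2)
      (hσ n) (hB n) hσB
    refine le_trans ?_ (two_pow_mul_le_momentBound (hB n) hn0 (hσ n) (by omega) (by omega) rfl x y)
    refine mul_le_mul_of_nonneg_left (hint.trans ?_) (by positivity)
    refine mul_le_mul_of_nonneg_left ?_ (by positivity)
    exact hsum
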